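/- Let $\mathcal{M}_n$ denote the complex $n\times n$ matrices and $\vartheta_n(X)=X^T$ the transposition on $\mathcal{M}_n$. A linear map $P:\mathcal{M}_n\to\mathcal{M}_m$ is completely positive if $\mathrm{id}_k\otimes P$ maps positive semidefinite matrices to positive semidefinite matrices for every $k\in\mathbb{N}$, and decomposable if $P=T_1+\vartheta_m\circ T_2$ with $T_1,T_2:\mathcal{M}_n\to\mathcal{M}_m$ completely positive. The Choi matrix of a linear map $L:\mathcal{M}_d\to\mathcal{M}_d$ is $C_L=(\mathrm{id}_d\otimes L)(\omega_d)$, where $\omega_d=|\Omega_d\rangle\langle\Omega_d|$ and $|\Omega_d\rangle=\sum_{i=1}^d|i\rangle\otimes|i\rangle$. For an integer $d\ge 2$ and $p\in[0,1]$ the Werner map $W_p:\mathcal{M}_d\to\mathcal{M}_d$ is the linear map with Choi matrix $$C_{W_p}=p\,\frac{P_{\mathrm{sym}}}{\operatorname{Tr}P_{\mathrm{sym}}}+(1-p)\,\frac{P_{\mathrm{asym}}}{\operatorname{Tr}P_{\mathrm{asym}}},\qquad P_{\mathrm{sym}}=\tfrac12(\mathbb{1}+\mathbb{F}),\quad P_{\mathrm{asym}}=\tfrac12(\mathbb{1}-\mathbb{F}),$$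 where $\mathbb{F}$ is the flip operator on $\mathbb{C}^d\otimes\mathbb{C}^d$, $\mathbb{F}(|i\rangle\otimes|j\rangle)=|j\rangle\otimes|i\rangle$. Theorem. Let $d\ge 2$ be an integer. (1) For all $p_1,p_2\in[0,1]$, the map $W_{p_1}\otimes(\vartheta_d\circ W_{p_2}):\mathcal{M}_{d^2}\to\mathcal{M}_{d^2}$ is decomposable if and only if $$\frac{d-1}{d+1}\,p_1p_2+(1-p_1)p_2+p_1(1-p_2)-(1-p_1)(1-p_2)\ \ge\ 0.$$ (2) For all $p\in[0,1]$, the map $W_p\otimes(\vartheta_d\circ W_p)$ is decomposable if and only if $$p\ \ge\ \frac{1}{2+\sqrt{\frac{2d}{d+1}}}.$$ -/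

import Mathlib

open scoped Kronecker ComplexOrder

noncomputable section

namespace WernerMaps

/-- The algebra of complex square matrices with rows and columns indexed by `ι`;
`Mat (Fin d)` is the algebra of complex `d × d` matrices, and `Mat (ι × κ)` is identified with
`Mat ι ⊗ Mat κ` through the Kronecker product. -/
abbrev Mat (ι : Type*) := Matrix ι ι ℂ

/-- The tensor product `L₁ ⊗ L₂` of two linear maps between matrix algebras, under the
identification of `Mat ι ⊗ Mat κ` with `Mat (ι × κ)` by the Kronecker product. -/
def tensorMap {ι κ ι' κ' : Type*} [Fintype ι] [Fintype κ] [Fintype ι'] [Fintype κ']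
    [DecidableEq ι] [DecidableEq κ] [DecidableEq ι'] [DecidableEq κ']
    (L₁ : Mat ι →ₗ[ℂ] Mat ι') (L₂ : Mat κ →ₗ[ℂ] Mat κ') :
    Mat (ι × κ) →ₗ[ℂ] Mat (ι' × κ') :=
  (kroneckerLinearEquiv ι' ι' κ' κ' ℂ).toLinearMap ∘ₗ
    TensorProduct.map L₁ L₂ ∘ₗ (kroneckerLinearEquiv ι ι κ κ ℂ).symm.toLinearMap

theorem tensorMap_kronecker {ι κ ι' κ' : Type*} [Fintype ι] [Fintype κ] [Fintype ι'] [Fintype κ']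
    [DecidableEq ι] [DecidableEq κ] [DecidableEq ι'] [DecidableEq κ']
    (L₁ : Mat ι →ₗ[ℂ] Mat ι') (L₂ : Mat κ →ₗ[ℂ] Mat κ') (X : Mat ι) (Y : Mat κ) :
    tensorMap L₁ L₂ (X ⊗ₖ Y) = L₁ X ⊗ₖ L₂ Y := by
  simp [tensorMap]

/-- A linear map is positive if it maps positive semidefinite matrices to positive semidefinite
matrices. -/
def IsPositiveMap {ι κ : Type*} (P : Mat ι →ₗ[ℂ] Mat κ) : Prop :=
  ∀ X : Mat ι, X.PosSemidef → (P X).PosSemidef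

/-- `P` is completely positive if `id_k ⊗ P` is positive for every `k`. -/
def IsCompletelyPositive {ι κ : Type*} [Fintype ι] [Fintype κ] [DecidableEq ι] [DecidableEq κ]
    (P : Mat ι →ₗ[ℂ] Mat κ) : Prop :=
  ∀ k : ℕ, IsPositiveMap (tensorMap (LinearMap.id : Mat (Fin k) →ₗ[ℂ] Mat (Fin k)) P)

/-- The matrix transposition as a linear map. -/
def transposeMap (ι : Type*) : Mat ι →ₗ[ℂ] Mat ι :=
  (Matrix.transposeLinearEquiv ι ι ℂ ℂ).toLinearMap

/-- `P` is decomposable if it is the sum of a completely positive map and of a completely positive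
map followed by the transposition. -/
def IsDecomposable {ι κ : Type*} [Fintype ι] [Fintype κ] [DecidableEq ι] [DecidableEq κ]
    (P : Mat ι →ₗ[ℂ] Mat κ) : Prop :=
  ∃ T₁ T₂ : Mat ι →ₗ[ℂ] Mat κ, IsCompletelyPositive T₁ ∧ IsCompletelyPositive T₂ ∧
    P = T₁ + transposeMap κ ∘ₗ T₂

/-- The vector `Ω = ∑ i, e_i ⊗ e_i`. -/
def maxEntVec (ι : Type*) [DecidableEq ι] : ι × ι → ℂ :=
  fun x => if x.1 = x.2 then 1 else 0

/-- The unnormalized maximally entangled state `ω = |Ω⟩⟨Ω|`. -/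
def maxEnt (ι : Type*) [DecidableEq ι] : Mat (ι × ι) :=
  Matrix.vecMulVec (maxEntVec ι) (star (maxEntVec ι))

/-- The Choi matrix `C_L = (id ⊗ L)(ω)`. -/
def choi {ι κ : Type*} [Fintype ι] [Fintype κ] [DecidableEq ι] [DecidableEq κ]
    (L : Mat ι →ₗ[ℂ] Mat κ) : Mat (ι × κ) :=
  tensorMap LinearMap.id L (maxEnt ι)

/-- The linear map with a given Choi matrix, `X ↦ ∑ i j, X i j • C_{(i,·),(j,·)}`; see `choi_ofChoi`
and `ofChoi_choi`. -/
def ofChoi {ι κ : Type*} [Fintype ι] (C : Mat (ι × κ)) : Mat ι →ₗ[ℂ] Mat κ where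
  toFun X := Matrix.of fun a b => ∑ i, ∑ j, X i j * C (i, a) (j, b)
  map_add' X Y := by
    ext a b
    simp [add_mul, Finset.sum_add_distrib]
  map_smul' c X := by
    ext a b
    simp [Finset.mul_sum, mul_assoc]

theorem maxEnt_eq_sum (ι : Type*) [Fintype ι] [DecidableEq ι] :
    maxEnt ι = ∑ i, ∑ j, Matrix.single i j (1 : ℂ) ⊗ₖ Matrix.single i j (1 : ℂ) := by
  ext ⟨a, b⟩ ⟨c, e⟩
  simp only [maxEnt, Matrix.vecMulVec_apply, maxEntVec, Pi.star_apply, Matrix.sum_apply,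
    Matrix.kronecker_apply, Matrix.single_apply]
  rw [Finset.sum_eq_single a, Finset.sum_eq_single c]
  · by_cases h1 : a = b <;> by_cases h2 : c = e <;> simp [h1, h2]
  · intro j _ hj
    simp [hj]
  · simp
  · intro i _ hi
    simp [hi]
  · simp

theorem choi_apply {ι κ : Type*} [Fintype ι] [Fintype κ] [DecidableEq ι] [DecidableEq κ]
    (L : Mat ι →ₗ[ℂ] Mat κ) (i j : ι) (a b : κ) :
    choi L (i, a) (j, b) = L (Matrix.single i j 1) a b := by
  simp only [choi, maxEnt_eq_sum, map_sum, tensorMap_kronecker, Matrix.sum_apply,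
    Matrix.kronecker_apply, LinearMap.id_apply, Matrix.single_apply]
  rw [Finset.sum_eq_single i, Finset.sum_eq_single j]
  · simp
  · intro k _ hk
    simp [hk]
  · simp
  · intro k _ hk
    simp [hk]
  · simp

theorem choi_ofChoi {ι κ : Type*} [Fintype ι] [Fintype κ] [DecidableEq ι] [DecidableEq κ]
    (C : Mat (ι × κ)) : choi (ofChoi C) = C := by
  ext ⟨i, a⟩ ⟨j, b⟩
  rw [choi_apply]
  simp only [ofChoi, LinearMap.coe_mk, AddHom.coe_mk, Matrix.of_apply, Matrix.single_apply]
  rw [Finset.sum_eq_single i, Finset.sum_eq_single j]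
  · simp
  · intro k _ hk
    simp [Ne.symm hk]
  · simp
  · intro k _ hk
    simp [Ne.symm hk]
  · simp

theorem ofChoi_choi {ι κ : Type*} [Fintype ι] [Fintype κ] [DecidableEq ι] [DecidableEq κ]
    (L : Mat ι →ₗ[ℂ] Mat κ) : ofChoi (choi L) = L := by
  refine LinearMap.ext fun X => ?_
  ext a b
  simp only [ofChoi, LinearMap.coe_mk, AddHom.coe_mk, Matrix.of_apply, choi_apply]
  conv_rhs => rw [Matrix.matrix_eq_sum_single X]
  simp only [map_sum, Matrix.sum_apply]
  refine Finset.sum_congr rfl fun i _ => Finset.sum_congr rfl fun j _ => ?_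
  have h : Matrix.single i j (X i j) = X i j • Matrix.single i j (1 : ℂ) := by
    simp [Matrix.smul_single]
  rw [h, map_smul, Matrix.smul_apply, smul_eq_mul]

/-- The flip operator `F (e_i ⊗ e_j) = e_j ⊗ e_i`. -/
def flipOp (d : ℕ) : Mat (Fin d × Fin d) :=
  Matrix.of fun x y => if x.1 = y.2 ∧ x.2 = y.1 then 1 else 0

/-- The projector onto the symmetric subspace. -/
def symProj (d : ℕ) : Mat (Fin d × Fin d) := (1 / 2 : ℂ) • (1 + flipOp d)

/-- The projector onto the antisymmetric subspace. -/
def asymProj (d : ℕ) : Mat (Fin d × Fin d) := (1 / 2 : ℂ) • (1 - flipOp d)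

theorem trace_flipOp (d : ℕ) : (flipOp d).trace = d := by
  simp only [flipOp, Matrix.trace, Matrix.diag_apply, Matrix.of_apply, Fintype.sum_prod_type]
  have h : ∀ i j : Fin d, (if i = j ∧ j = i then (1 : ℂ) else 0) = if i = j then 1 else 0 := by
    intro i j
    by_cases hij : i = j <;> simp [hij]
  simp [h]

theorem trace_symProj (d : ℕ) : (symProj d).trace = d * (d + 1) / 2 := by
  rw [symProj, Matrix.trace_smul, Matrix.trace_add, trace_flipOp, Matrix.trace_one]
  simp
  ring

theorem trace_asymProj (d : ℕ) : (asymProj d).trace = d * (d - 1) / 2 := by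
  rw [asymProj, Matrix.trace_smul, Matrix.trace_sub, trace_flipOp, Matrix.trace_one]
  simp
  ring

/-- The Werner state `ρ_W(p) = p P_sym / tr P_sym + (1 - p) P_asym / tr P_asym`
(a meaningful object for `2 ≤ d`, where both traces are nonzero). -/
def wernerState (d : ℕ) (p : ℝ) : Mat (Fin d × Fin d) :=
  ((p : ℂ) / (symProj d).trace) • symProj d +
    (((1 - p : ℝ) : ℂ) / (asymProj d).trace) • asymProj d

/-- The Werner map `W_p`, the linear map whose Choi matrix is the Werner state `ρ_W(p)`. -/
def wernerMap (d : ℕ) (p : ℝ) : Mat (Fin d) →ₗ[ℂ] Mat (Fin d) := ofChoi (wernerState d p)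

theorem choi_wernerMap (d : ℕ) (p : ℝ) : choi (wernerMap d p) = wernerState d p :=
  choi_ofChoi _

end WernerMaps

end

namespace WernerMaps

open Matrix

/-! By Choi's theorem, a map is decomposable iff its Choi matrix is `X + ptrans Y` with `X`, `Y`
positive semidefinite. Write F for the flip and ω for its partial transpose `maxEnt`. The Choi
matrix of the map in (1) is then, up to a positive factor, (s₁ - t₁F) ⊗ (s₂ - t₂ω) with sᵢ = d+1-2pᵢ
and tᵢ = d+1-2dpᵢ.

Necessity: `pptWitness` is positive semidefinite with positive semidefinite partial transpose, so
its trace pairing with a decomposable Choi matrix is nonnegative; this pairing is a positive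
multiple of the expression in (1).

Sufficiency: if some pᵢ ≥ 1/2, the Choi matrix or its partial transpose is positive semidefinite.
Otherwise both tᵢ > 0, and `isDecomposableChoi_pairProd` gives an explicit decomposition in terms of
rᵢ = sᵢ/tᵢ. Part (2) factors the quadratic obtained for p₁ = p₂. -/

/-! ### Partial transposition and Choi's theorem. -/

/-- Partial transposition of the second tensor factor. -/
def ptrans {ι κ : Type*} (C : Mat (ι × κ)) : Mat (ι × κ) :=
  Matrix.of fun x y => C (x.1, y.2) (y.1, x.2)

@[simp] theorem ptrans_apply {ι κ : Type*} (C : Mat (ι × κ)) (x y : ι × κ) :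
    ptrans C x y = C (x.1, y.2) (y.1, x.2) := rfl

@[simp] theorem ptrans_ptrans {ι κ : Type*} (C : Mat (ι × κ)) : ptrans (ptrans C) = C := rfl

theorem trace_ptrans_mul {ι κ : Type*} [Fintype ι] [Fintype κ] (X Y : Mat (ι × κ)) :
    (ptrans X * Y).trace = (X * ptrans Y).trace := by
  simp only [Matrix.trace, Matrix.diag_apply, Matrix.mul_apply, ptrans_apply,
    Fintype.sum_prod_type]
  refine Finset.sum_congr rfl fun i _ => ?_
  rw [Finset.sum_comm]
  conv_rhs => rw [Finset.sum_comm]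
  refine Finset.sum_congr rfl fun j _ => ?_
  rw [Finset.sum_comm]

theorem choi_transposeMap_comp {ι κ : Type*} [Fintype ι] [Fintype κ] [DecidableEq ι]
    [DecidableEq κ] (L : Mat ι →ₗ[ℂ] Mat κ) : choi (transposeMap κ ∘ₗ L) = ptrans (choi L) := by
  ext ⟨i, a⟩ ⟨j, b⟩
  simp [choi_apply, transposeMap]

theorem choi_add {ι κ : Type*} [Fintype ι] [Fintype κ] [DecidableEq ι]
    [DecidableEq κ] (L M : Mat ι →ₗ[ℂ] Mat κ) : choi (L + M) = choi L + choi M := by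
  ext ⟨i, a⟩ ⟨j, b⟩
  simp [choi_apply]

theorem choi_injective {ι κ : Type*} [Fintype ι] [Fintype κ] [DecidableEq ι]
    [DecidableEq κ] : Function.Injective (choi : (Mat ι →ₗ[ℂ] Mat κ) → Mat (ι × κ)) :=
  Function.LeftInverse.injective ofChoi_choi

theorem tensorMap_id_apply {ι κ μ : Type*} [Fintype ι] [Fintype κ] [Fintype μ] [DecidableEq ι]
    [DecidableEq κ] [DecidableEq μ] (L : Mat ι →ₗ[ℂ] Mat κ) (X : Mat (μ × ι)) (u v : μ) (a b : κ) :
    tensorMap LinearMap.id L X (u, a) (v, b) =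
      ∑ i, ∑ j, X (u, i) (v, j) * choi L (i, a) (j, b) := by
  have h (x y : μ × ι) : tensorMap LinearMap.id L (Matrix.single x y (X x y)) =
      X x y • (Matrix.single x.1 y.1 (1 : ℂ) ⊗ₖ L (Matrix.single x.2 y.2 1)) := by
    have : Matrix.single x y (X x y) =
        X x y • (Matrix.single x.1 y.1 (1 : ℂ) ⊗ₖ Matrix.single x.2 y.2 (1 : ℂ)) := by
      rw [Matrix.single_kronecker_single]
      simp [Matrix.smul_single]
    rw [this, map_smul, tensorMap_kronecker, LinearMap.id_apply]
  conv_lhs => rw [Matrix.matrix_eq_sum_single X]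
  simp only [map_sum, h, Matrix.sum_apply, Fintype.sum_prod_type, Matrix.smul_apply,
    Matrix.kronecker_apply, Matrix.single_apply, smul_eq_mul, choi_apply]
  rw [Finset.sum_eq_single u]
  · refine Finset.sum_congr rfl fun i _ => ?_
    rw [Finset.sum_eq_single v]
    · simp
    · intro w _ hw
      simp [hw]
    · simp
  · intro w _ hw
    simp [hw]
  · simp

theorem posSemidef_maxEnt (ι : Type*) [Fintype ι] [DecidableEq ι] : (maxEnt ι).PosSemidef :=
  Matrix.posSemidef_vecMulVec_self_star _

theorem maxEnt_apply {ι : Type*} [DecidableEq ι] (x y : ι × ι) :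
    maxEnt ι x y = if x.1 = x.2 ∧ y.1 = y.2 then 1 else 0 := by
  by_cases h1 : x.1 = x.2 <;> by_cases h2 : y.1 = y.2 <;>
    simp [maxEnt, maxEntVec, Matrix.vecMulVec_apply, h1, h2]

/-- Choi's theorem. -/
theorem isCompletelyPositive_iff_posSemidef_choi {ι κ : Type*} [Fintype ι] [Fintype κ]
    [DecidableEq ι] [DecidableEq κ] (L : Mat ι →ₗ[ℂ] Mat κ) :
    IsCompletelyPositive L ↔ (choi L).PosSemidef := by
  constructor
  · intro h
    -- The ancilla has dimension `card ι`, so `maxEnt ι` can be transported to it along `e`.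
    let e := Fintype.equivFin ι
    have h1 := (h (Fintype.card ι) _ ((posSemidef_maxEnt ι).submatrix
      (fun x : Fin (Fintype.card ι) × ι => (e.symm x.1, x.2)))).submatrix
      (fun x : ι × κ => (e x.1, x.2))
    convert h1 using 1
    ext ⟨i, a⟩ ⟨j, b⟩
    rw [Matrix.submatrix_apply, tensorMap_id_apply]
    simp only [Matrix.submatrix_apply, maxEnt_apply, Equiv.symm_apply_apply]
    rw [Finset.sum_eq_single i, Finset.sum_eq_single j]
    · simp
    · intro k _ hk
      simp [hk.symm]
    · simp
    · intro k _ hk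
      simp [hk.symm]
    · simp
  · intro h k X hX
    -- `V` contracts the input index of `X` with that of `choi L`, so the output is Vᴴ (X ⊗ `choi
    -- L`) V.
    let V : Matrix ((Fin k × ι) × (ι × κ)) (Fin k × κ) ℂ := Matrix.of fun x y =>
      if x.1.1 = y.1 ∧ x.1.2 = x.2.1 ∧ x.2.2 = y.2 then 1 else 0
    have h1 := (hX.kronecker h).conjTranspose_mul_mul_same V
    refine (congrArg Matrix.PosSemidef ?_).mpr h1
    ext ⟨u, a⟩ ⟨v, b⟩
    rw [tensorMap_id_apply]
    simp only [Matrix.mul_apply, V, Matrix.conjTranspose_apply, Matrix.of_apply,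
      Fintype.sum_prod_type, Matrix.kronecker_apply, apply_ite star, star_one, star_zero,
      ite_mul, mul_ite, one_mul, mul_one, zero_mul, mul_zero, ite_and]
    simp
    rw [Finset.sum_comm]

theorem isDecomposable_iff_choi {ι κ : Type*} [Fintype ι] [Fintype κ]
    [DecidableEq ι] [DecidableEq κ] (L : Mat ι →ₗ[ℂ] Mat κ) :
    IsDecomposable L ↔
      ∃ X Y : Mat (ι × κ), X.PosSemidef ∧ Y.PosSemidef ∧ choi L = X + ptrans Y := by
  constructor
  · rintro ⟨T₁, T₂, h1, h2, rfl⟩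
    exact ⟨choi T₁, choi T₂, (isCompletelyPositive_iff_posSemidef_choi _).1 h1,
      (isCompletelyPositive_iff_posSemidef_choi _).1 h2, by
        rw [choi_add, choi_transposeMap_comp]⟩
  · rintro ⟨X, Y, hX, hY, h⟩
    refine ⟨ofChoi X, ofChoi Y, ?_, ?_, ?_⟩
    · rwa [isCompletelyPositive_iff_posSemidef_choi, choi_ofChoi]
    · rwa [isCompletelyPositive_iff_posSemidef_choi, choi_ofChoi]
    · apply choi_injective
      rw [choi_add, choi_transposeMap_comp, choi_ofChoi, choi_ofChoi, h]

/-! ### Regrouped tensor products of bipartite matrices. -/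

/-- The tensor product of two bipartite matrices, with the factors regrouped. -/
def pairProd {ι κ ι' κ' : Type*} (M : Mat (ι × κ)) (N : Mat (ι' × κ')) :
    Mat ((ι × ι') × (κ × κ')) :=
  (M ⊗ₖ N).submatrix (Equiv.prodProdProdComm ι ι' κ κ') (Equiv.prodProdProdComm ι ι' κ κ')

section pairProd

variable {ι κ ι' κ' : Type*}

theorem pairProd_apply (M : Mat (ι × κ)) (N : Mat (ι' × κ'))
    (x y : (ι × ι') × (κ × κ')) : pairProd M N x y =
      M (x.1.1, x.2.1) (y.1.1, y.2.1) * N (x.1.2, x.2.2) (y.1.2, y.2.2) := rfl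

theorem ptrans_pairProd (M : Mat (ι × κ)) (N : Mat (ι' × κ')) :
    ptrans (pairProd M N) = pairProd (ptrans M) (ptrans N) := rfl

variable [Fintype ι] [Fintype κ] [Fintype ι'] [Fintype κ']

theorem posSemidef_pairProd {M : Mat (ι × κ)} {N : Mat (ι' × κ')}
    (hM : M.PosSemidef) (hN : N.PosSemidef) : (pairProd M N).PosSemidef :=
  (hM.kronecker hN).submatrix _

theorem trace_pairProd_mul (M M' : Mat (ι × κ)) (N N' : Mat (ι' × κ')) :
    (pairProd M N * pairProd M' N').trace = (M * M').trace * (N * N').trace := by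
  rw [pairProd, pairProd, Matrix.submatrix_mul_equiv, ← Matrix.mul_kronecker_mul,
    ← Matrix.trace_kronecker]
  exact Equiv.sum_comp (Equiv.prodProdProdComm ι ι' κ κ')
    (fun i => ((M * M') ⊗ₖ (N * N')) i i)

theorem choi_tensorMap [DecidableEq ι] [DecidableEq κ] [DecidableEq ι'] [DecidableEq κ']
    (L : Mat ι →ₗ[ℂ] Mat κ) (L' : Mat ι' →ₗ[ℂ] Mat κ') :
    choi (tensorMap L L') = pairProd (choi L) (choi L') := by
  ext ⟨⟨i, i'⟩, ⟨a, a'⟩⟩ ⟨⟨j, j'⟩, ⟨b, b'⟩⟩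
  have h : Matrix.single (i, i') (j, j') (1 : ℂ) =
      Matrix.single i j (1 : ℂ) ⊗ₖ Matrix.single i' j' (1 : ℂ) := by
    rw [Matrix.single_kronecker_single]
    simp
  rw [choi_apply, pairProd_apply, choi_apply, choi_apply, h, tensorMap_kronecker,
    Matrix.kronecker_apply]

end pairProd

open scoped MatrixOrder Matrix.Norms.L2Operator in
theorem trace_mul_nonneg {ι : Type*} [Fintype ι] {X Y : Mat ι}
    (hX : X.PosSemidef) (hY : Y.PosSemidef) : 0 ≤ (X * Y).trace := by
  classical
  obtain ⟨B, rfl⟩ := CStarAlgebra.nonneg_iff_eq_star_mul_self.mp (Matrix.nonneg_iff_posSemidef.2 hX)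
  rw [Matrix.mul_assoc, Matrix.trace_mul_comm]
  exact (hY.mul_mul_conjTranspose_same B).trace_nonneg

/-! ### Algebra and positivity of F and ω, from F² = 1 and ω² = dω. -/

section flip

variable (d : ℕ)

theorem ptrans_flipOp : ptrans (flipOp d) = maxEnt (Fin d) := by
  ext x y
  rw [maxEnt_apply, ptrans_apply, flipOp, Matrix.of_apply]
  exact if_congr (and_congr_right fun _ => eq_comm) rfl rfl

theorem ptrans_maxEnt : ptrans (maxEnt (Fin d)) = flipOp d := by
  rw [← ptrans_flipOp, ptrans_ptrans]

theorem ptrans_one {ι κ : Type*} [DecidableEq ι] [DecidableEq κ] :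
    ptrans (1 : Mat (ι × κ)) = 1 := by
  ext ⟨i, a⟩ ⟨j, b⟩
  simp [Matrix.one_apply, eq_comm]

theorem flipOp_mul_self : flipOp d * flipOp d = 1 := by
  ext ⟨i, a⟩ ⟨j, b⟩
  simp only [Matrix.mul_apply, flipOp, Matrix.of_apply, Fintype.sum_prod_type, Matrix.one_apply,
    ite_and, mul_ite, mul_one, mul_zero, Prod.mk.injEq]
  rw [Finset.sum_eq_single a, Finset.sum_eq_single i]
  · simp [← ite_and, and_comm]
  all_goals simp +contextual [eq_comm]

theorem isHermitian_flipOp : (flipOp d).IsHermitian := by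
  ext x y
  simp only [Matrix.conjTranspose_apply, flipOp, Matrix.of_apply, apply_ite star, star_one,
    star_zero]
  exact if_congr ⟨fun h => ⟨h.2.symm, h.1.symm⟩, fun h => ⟨h.2.symm, h.1.symm⟩⟩ rfl rfl

theorem trace_maxEnt : (maxEnt (Fin d)).trace = d := by
  simp only [Matrix.trace, Matrix.diag_apply, maxEnt_apply, Fintype.sum_prod_type, and_self]
  simp

theorem maxEnt_mul_self : maxEnt (Fin d) * maxEnt (Fin d) = (d : ℂ) • maxEnt (Fin d) := by
  have h : star (maxEntVec (Fin d)) ⬝ᵥ maxEntVec (Fin d) = d := by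
    simp [dotProduct, maxEntVec, Fintype.sum_prod_type]
  rw [maxEnt, Matrix.vecMulVec_mul_vecMulVec, h]
  ext x y
  simp [Matrix.vecMulVec_apply]
  ring

theorem posSemidef_one_add_flipOp : (1 + flipOp d).PosSemidef := by
  have h : (1 + flipOp d) = (1 / 2 : ℂ) • ((1 + flipOp d)ᴴ * (1 + flipOp d)) := by
    rw [Matrix.conjTranspose_add, Matrix.conjTranspose_one, (isHermitian_flipOp d).eq]
    simp only [add_mul, mul_add, flipOp_mul_self, one_mul, mul_one]
    module
  rw [h]
  exact (Matrix.posSemidef_conjTranspose_mul_self _).smul (by norm_num [Complex.le_def])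

theorem posSemidef_one_sub_flipOp : (1 - flipOp d).PosSemidef := by
  have h : (1 - flipOp d) = (1 / 2 : ℂ) • ((1 - flipOp d)ᴴ * (1 - flipOp d)) := by
    rw [Matrix.conjTranspose_sub, Matrix.conjTranspose_one, (isHermitian_flipOp d).eq]
    simp only [sub_mul, mul_sub, flipOp_mul_self, one_mul, mul_one]
    module
  rw [h]
  exact (Matrix.posSemidef_conjTranspose_mul_self _).smul (by norm_num [Complex.le_def])

theorem posSemidef_smul_one_sub_flipOp {r : ℝ} (hr : 1 ≤ r) :
    ((r : ℂ) • 1 - flipOp d).PosSemidef := by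
  have h : ((r : ℂ) • 1 - flipOp d) = ((r - 1 : ℝ) : ℂ) • 1 + (1 - flipOp d) := by
    push_cast
    module
  rw [h]
  exact (Matrix.PosSemidef.one.smul (by exact_mod_cast sub_nonneg.2 hr)).add
    (posSemidef_one_sub_flipOp d)

theorem posSemidef_card_sub_maxEnt (hd : 0 < d) : ((d : ℂ) • 1 - maxEnt (Fin d)).PosSemidef := by
  have hd' : (d : ℂ) ≠ 0 := by exact_mod_cast hd.ne'
  have h : ((d : ℂ) • 1 - maxEnt (Fin d)) = ((1 / d : ℝ) : ℂ) •
      (((d : ℂ) • 1 - maxEnt (Fin d))ᴴ * ((d : ℂ) • 1 - maxEnt (Fin d))) := by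
    rw [Matrix.conjTranspose_sub, Matrix.conjTranspose_smul, Matrix.conjTranspose_one,
      (posSemidef_maxEnt (Fin d)).isHermitian.eq]
    simp only [sub_mul, mul_sub, maxEnt_mul_self, smul_mul_assoc, mul_smul_comm, one_mul, mul_one,
      star_natCast, smul_sub, smul_smul]
    push_cast
    match_scalars <;> field_simp
    ring
  rw [h]
  refine (Matrix.posSemidef_conjTranspose_mul_self _).smul ?_
  have : (0 : ℝ) ≤ 1 / d := by positivity
  exact_mod_cast this

end flip

/-! ### The convex cone of decomposable Choi matrices. -/

/-- The Choi matrices of decomposable maps. -/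
def IsDecomposableChoi {ι κ : Type*} (C : Mat (ι × κ)) : Prop :=
  ∃ X Y : Mat (ι × κ), X.PosSemidef ∧ Y.PosSemidef ∧ C = X + ptrans Y

theorem IsDecomposableChoi.of_posSemidef {ι κ : Type*} {C : Mat (ι × κ)} (h : C.PosSemidef) :
    IsDecomposableChoi C :=
  ⟨C, 0, h, Matrix.PosSemidef.zero, (add_zero C).symm⟩

theorem IsDecomposableChoi.of_posSemidef_ptrans {ι κ : Type*} {C : Mat (ι × κ)}
    (h : (ptrans C).PosSemidef) : IsDecomposableChoi C :=
  ⟨0, ptrans C, Matrix.PosSemidef.zero, h, (zero_add C).symm⟩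

theorem IsDecomposableChoi.add {ι κ : Type*} {C D : Mat (ι × κ)}
    (hC : IsDecomposableChoi C) (hD : IsDecomposableChoi D) : IsDecomposableChoi (C + D) := by
  obtain ⟨X, Y, hX, hY, rfl⟩ := hC
  obtain ⟨X', Y', hX', hY', rfl⟩ := hD
  refine ⟨X + X', Y + Y', hX.add hX', hY.add hY', ?_⟩
  ext x y
  simp only [Matrix.add_apply, ptrans_apply]
  ring

theorem IsDecomposableChoi.smul {ι κ : Type*} {C : Mat (ι × κ)}
    (hC : IsDecomposableChoi C) {r : ℝ} (hr : 0 ≤ r) : IsDecomposableChoi ((r : ℂ) • C) := by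
  obtain ⟨X, Y, hX, hY, rfl⟩ := hC
  have hr' : (0 : ℂ) ≤ r := by exact_mod_cast hr
  refine ⟨(r : ℂ) • X, (r : ℂ) • Y, hX.smul hr', hY.smul hr', ?_⟩
  ext x y
  simp only [Matrix.add_apply, Matrix.smul_apply, ptrans_apply, smul_add]

theorem ptrans_sub {ι κ : Type*} (C D : Mat (ι × κ)) :
    ptrans (C - D) = ptrans C - ptrans D := rfl

theorem ptrans_add {ι κ : Type*} (C D : Mat (ι × κ)) :
    ptrans (C + D) = ptrans C + ptrans D := rfl

theorem ptrans_smul {ι κ : Type*} (c : ℂ) (C : Mat (ι × κ)) : ptrans (c • C) = c • ptrans C := rfl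

/-! ### Werner states and their partial transposes. -/

section decomposition

variable (d : ℕ)

theorem wernerState_eq (hd : 2 ≤ d) (p : ℝ) :
    wernerState d p = ((1 / (d * (d ^ 2 - 1)) : ℝ) : ℂ) •
      (((d + 1 - 2 * p : ℝ) : ℂ) • 1 - ((d + 1 - 2 * d * p : ℝ) : ℂ) • flipOp d) := by
  have h0 : (d : ℂ) ≠ 0 := by exact_mod_cast (by omega : d ≠ 0)
  have h1 : (d : ℂ) - 1 ≠ 0 := sub_ne_zero.2 (by exact_mod_cast (by omega : d ≠ 1))
  have h2 : (d : ℂ) + 1 ≠ 0 := by exact_mod_cast (by omega : d + 1 ≠ 0)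
  have h3 : (d : ℂ) ^ 2 - 1 ≠ 0 := by
    rw [show (d : ℂ) ^ 2 - 1 = (d - 1) * (d + 1) by ring]
    exact mul_ne_zero h1 h2
  rw [wernerState, trace_symProj, trace_asymProj, symProj, asymProj]
  push_cast
  match_scalars
  · field_simp
    ring
  · field_simp
    ring

theorem posSemidef_wernerState (hd : 2 ≤ d) {p : ℝ} (hp : p ∈ Set.Icc (0 : ℝ) 1) :
    (wernerState d p).PosSemidef := by
  have h1 : (1 : ℝ) < d := by exact_mod_cast hd
  have hk : 0 ≤ 1 / ((d : ℝ) * (d ^ 2 - 1)) := by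
    have : (0 : ℝ) ≤ d ^ 2 - 1 := by nlinarith
    positivity
  have hs : 0 ≤ p * (d - 1) := mul_nonneg hp.1 (by linarith)
  have ha : 0 ≤ (1 - p) * (d + 1) := mul_nonneg (by linarith [hp.2]) (by linarith)
  rw [wernerState_eq d hd]
  refine Matrix.PosSemidef.smul ?_ (by exact_mod_cast hk)
  have h : (((d + 1 - 2 * p : ℝ) : ℂ) • 1 - ((d + 1 - 2 * d * p : ℝ) : ℂ) • flipOp d) =
      ((p * (d - 1) : ℝ) : ℂ) • (1 + flipOp d) +
        (((1 - p) * (d + 1) : ℝ) : ℂ) • (1 - flipOp d) := by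
    push_cast
    match_scalars <;> ring
  rw [h]
  exact ((posSemidef_one_add_flipOp d).smul (by exact_mod_cast hs)).add
    ((posSemidef_one_sub_flipOp d).smul (by exact_mod_cast ha))

theorem ptrans_wernerState_eq (hd : 2 ≤ d) (p : ℝ) :
    ptrans (wernerState d p) = ((1 / (d * (d ^ 2 - 1)) : ℝ) : ℂ) •
      (((d + 1 - 2 * p : ℝ) : ℂ) • 1 - ((d + 1 - 2 * d * p : ℝ) : ℂ) • maxEnt (Fin d)) := by
  rw [wernerState_eq d hd, ptrans_smul, ptrans_sub, ptrans_smul, ptrans_smul, ptrans_one,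
    ptrans_flipOp]

theorem posSemidef_ptrans_wernerState (hd : 2 ≤ d) {p : ℝ} (hp : p ∈ Set.Icc (1 / 2 : ℝ) 1) :
    (ptrans (wernerState d p)).PosSemidef := by
  have h1 : (1 : ℝ) < d := by exact_mod_cast hd
  have hk : 0 ≤ 1 / ((d : ℝ) * (d ^ 2 - 1)) := by
    have : (0 : ℝ) ≤ d ^ 2 - 1 := by nlinarith
    positivity
  have hd0 : (d : ℂ) ≠ 0 := by exact_mod_cast (by omega : d ≠ 0)
  have hs : 0 ≤ (d ^ 2 - 1) * (2 * p - 1) / d :=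
    div_nonneg (mul_nonneg (by nlinarith) (by linarith [hp.1])) (by linarith)
  have ha : 0 ≤ (d + 1 - 2 * p) / d := div_nonneg (by linarith [hp.2]) (by linarith)
  rw [ptrans_wernerState_eq d hd]
  refine Matrix.PosSemidef.smul ?_ (by exact_mod_cast hk)
  -- Spectral decomposition: eigenvalue (d²-1)(2p-1) on Ω and d+1-2p on its complement; the factors
  -- 1/d normalise ω and d - ω to projectors.
  have h : (((d + 1 - 2 * p : ℝ) : ℂ) • 1 - ((d + 1 - 2 * d * p : ℝ) : ℂ) • maxEnt (Fin d)) =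
      (((d + 1 - 2 * p) / d : ℝ) : ℂ) • ((d : ℂ) • 1 - maxEnt (Fin d)) +
        (((d ^ 2 - 1) * (2 * p - 1) / d : ℝ) : ℂ) • maxEnt (Fin d) := by
    push_cast
    match_scalars <;> field_simp
    ring
  rw [h]
  exact ((posSemidef_card_sub_maxEnt d (by omega)).smul (by exact_mod_cast ha)).add
    ((posSemidef_maxEnt (Fin d)).smul (by exact_mod_cast hs))

/-! ### Sufficiency: an explicit decomposition. -/

/-- The hypotheses compare the coefficients of 1⊗1, F⊗1, 1⊗ω and F⊗ω. -/
theorem pairProd_decomposition {r₁ r₂ r x x' y : ℝ}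
    (h₁ : r₁ * r₂ = (r₁ - r) * r₂ + d * x' + d * y) (h₂ : r₂ = d * x' + y)
    (h₃ : r₁ = (r₁ - r) - x + x' + d * y) (h₄ : 1 = x + x' + y) :
    pairProd ((r₁ : ℂ) • 1 - flipOp d) ((r₂ : ℂ) • 1 - maxEnt (Fin d)) =
      ((r₁ - r : ℝ) : ℂ) • pairProd 1 ((r₂ : ℂ) • 1 - maxEnt (Fin d)) +
      (x : ℂ) • pairProd (1 + flipOp d) (maxEnt (Fin d)) +
      (x' : ℂ) • pairProd (1 - flipOp d) ((d : ℂ) • 1 - maxEnt (Fin d)) +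
      (y : ℂ) • pairProd ((d : ℂ) • 1 - flipOp d) (1 - maxEnt (Fin d)) := by
  replace h₁ : (r₁ * r₂ : ℂ) = (r₁ - r) * r₂ + d * x' + d * y := by exact_mod_cast h₁
  replace h₂ : (r₂ : ℂ) = d * x' + y := by exact_mod_cast h₂
  replace h₃ : (r₁ : ℂ) = (r₁ - r) - x + x' + d * y := by exact_mod_cast h₃
  replace h₄ : (1 : ℂ) = x + x' + y := by exact_mod_cast h₄
  ext u v
  simp only [Matrix.add_apply, Matrix.smul_apply, pairProd_apply, Matrix.sub_apply, smul_eq_mul,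
    Complex.ofReal_sub]
  generalize (1 : Mat (Fin d × Fin d)) (u.1.1, u.2.1) (v.1.1, v.2.1) = a
  generalize (1 : Mat (Fin d × Fin d)) (u.1.2, u.2.2) (v.1.2, v.2.2) = b
  generalize flipOp d (u.1.1, u.2.1) (v.1.1, v.2.1) = f
  generalize maxEnt (Fin d) (u.1.2, u.2.2) (v.1.2, v.2.2) = w
  linear_combination a * b * h₁ - f * b * h₂ - a * w * h₃ + f * w * h₄

theorem isDecomposableChoi_pairProd (hd : 2 ≤ d) {r₁ r₂ : ℝ} (h₂ : 1 ≤ r₂) (h₂' : r₂ ≤ d)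
    (h : d * (r₁ + r₂ + 1) ≤ (d + 2) * (r₁ * r₂)) :
    IsDecomposableChoi
      (pairProd ((r₁ : ℂ) • 1 - flipOp d) ((r₂ : ℂ) • 1 - maxEnt (Fin d))) := by
  have h1 : (1 : ℝ) < d := by exact_mod_cast hd
  have hpos : 0 < (d + 2) * r₂ - d := by nlinarith
  -- `r` is the value of `r₁` giving equality in `h`; the excess `r₁ - r` is absorbed by the term 1
  -- ⊗ (r₂ - ω).
  obtain ⟨r, hr⟩ : ∃ r : ℝ, r = d * (r₂ + 1) / ((d + 2) * r₂ - d) := ⟨_, rfl⟩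
  have hreq : r * ((d + 2) * r₂ - d) = d * (r₂ + 1) := by
    rw [hr, div_mul_cancel₀ _ hpos.ne']
  have hr1 : 1 ≤ r := by
    rw [hr, le_div_iff₀ hpos]
    nlinarith
  have hrd : r ≤ d := by
    rw [hr, div_le_iff₀ hpos]
    nlinarith [mul_nonneg (sub_nonneg.2 h1.le) (sub_nonneg.2 h₂)]
  have hrr : r ≤ r₁ := by
    rw [hr, div_le_iff₀ hpos]
    linarith
  -- Equivalent to (r₂ - 1)(d - r₂) ≥ 0.
  have hx : 0 ≤ 1 - r * r₂ / d := by
    rw [sub_nonneg, div_le_one (by linarith), hr, div_mul_eq_mul_div, div_le_iff₀ hpos]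
    nlinarith [mul_nonneg (sub_nonneg.2 h₂) (sub_nonneg.2 h₂')]
  have hx' : 0 ≤ r₂ * (d - r) / (d * (d - 1)) :=
    div_nonneg (mul_nonneg (by linarith) (by linarith)) (mul_nonneg (by linarith) (by linarith))
  have hy : 0 ≤ r₂ * (r - 1) / (d - 1) :=
    div_nonneg (mul_nonneg (by linarith) (by linarith)) (by linarith)
  have hd1 : (d : ℝ) - 1 ≠ 0 := by linarith
  have hd0 : (d : ℝ) ≠ 0 := by linarith
  -- Three of the coefficient equations determine `x`, `x'`, `y`; the remaining one, for 1⊗ω, holds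
  -- because of `hreq`.
  rw [pairProd_decomposition d (r := r) (x := 1 - r * r₂ / d)
    (x' := r₂ * (d - r) / (d * (d - 1))) (y := r₂ * (r - 1) / (d - 1))]
  · refine (((IsDecomposableChoi.smul ?_ (by linarith)).add (.smul ?_ hx)).add
      (.smul ?_ hx')).add (.smul ?_ hy)
    · refine .of_posSemidef_ptrans ?_
      rw [ptrans_pairProd, ptrans_sub, ptrans_smul, ptrans_one, ptrans_maxEnt]
      exact posSemidef_pairProd .one (posSemidef_smul_one_sub_flipOp d h₂)
    · exact .of_posSemidef (posSemidef_pairProd (posSemidef_one_add_flipOp d) (posSemidef_maxEnt _))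
    · exact .of_posSemidef (posSemidef_pairProd (posSemidef_one_sub_flipOp d)
        (posSemidef_card_sub_maxEnt d (by omega)))
    · refine .of_posSemidef_ptrans ?_
      rw [ptrans_pairProd, ptrans_sub, ptrans_sub, ptrans_smul, ptrans_one,
        ptrans_maxEnt, ptrans_flipOp]
      exact posSemidef_pairProd (posSemidef_card_sub_maxEnt d (by omega))
        (posSemidef_one_sub_flipOp d)
  · field_simp
    ring
  · field_simp
    ring
  · field_simp
    linear_combination -(d - 1 : ℝ) * hreq
  · field_simp
    ring

/-! ### Necessity: the witness. -/

/-- A state with positive partial transpose that detects non-decomposability. -/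
def pptWitness : Mat ((Fin d × Fin d) × (Fin d × Fin d)) :=
  pairProd (1 + flipOp d) ((d : ℂ) • 1 - maxEnt (Fin d)) +
    ((d + 1 : ℝ) : ℂ) • pairProd (1 - flipOp d) (maxEnt (Fin d))

theorem posSemidef_pptWitness (hd : 0 < d) : (pptWitness d).PosSemidef :=
  (posSemidef_pairProd (posSemidef_one_add_flipOp d) (posSemidef_card_sub_maxEnt d hd)).add
    ((posSemidef_pairProd (posSemidef_one_sub_flipOp d) (posSemidef_maxEnt _)).smul
      (by exact_mod_cast (by positivity : (0 : ℝ) ≤ d + 1)))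

/-- The weight d + 1 is chosen so that partial transposition merely exchanges the two tensor
factors, which makes positivity of the result evident. -/
theorem ptrans_pptWitness : ptrans (pptWitness d) =
    pairProd ((d : ℂ) • 1 - maxEnt (Fin d)) (1 + flipOp d) +
      ((d + 1 : ℝ) : ℂ) • pairProd (maxEnt (Fin d)) (1 - flipOp d) := by
  rw [pptWitness, ptrans_add, ptrans_smul, ptrans_pairProd, ptrans_pairProd, ptrans_sub,
    ptrans_sub, ptrans_add, ptrans_smul, ptrans_one, ptrans_flipOp, ptrans_maxEnt]
  ext u v
  simp only [Matrix.add_apply, Matrix.smul_apply, pairProd_apply, Matrix.sub_apply, smul_eq_mul]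
  push_cast
  ring

theorem posSemidef_ptrans_pptWitness (hd : 0 < d) : (ptrans (pptWitness d)).PosSemidef := by
  rw [ptrans_pptWitness]
  exact (posSemidef_pairProd (posSemidef_card_sub_maxEnt d hd) (posSemidef_one_add_flipOp d)).add
    ((posSemidef_pairProd (posSemidef_maxEnt _) (posSemidef_one_sub_flipOp d)).smul
      (by exact_mod_cast (by positivity : (0 : ℝ) ≤ d + 1)))

theorem IsDecomposableChoi.trace_mul_pptWitness_nonneg (hd : 0 < d)
    {C : Mat ((Fin d × Fin d) × (Fin d × Fin d))} (hC : IsDecomposableChoi C) :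
    0 ≤ (C * pptWitness d).trace := by
  obtain ⟨X, Y, hX, hY, rfl⟩ := hC
  rw [add_mul, Matrix.trace_add, trace_ptrans_mul]
  exact add_nonneg (trace_mul_nonneg hX (posSemidef_pptWitness d hd))
    (trace_mul_nonneg hY (posSemidef_ptrans_pptWitness d hd))

theorem trace_pairProd_mul_pptWitness (s t s' t' : ℂ) :
    (pairProd (s • 1 - t • flipOp d) (s' • 1 - t' • maxEnt (Fin d)) * pptWitness d).trace =
      (s - t) * (d ^ 2 + d) * (s' * d * (d ^ 2 - 1)) +
        (d + 1) * ((s + t) * (d ^ 2 - d) * ((s' - t' * d) * d)) := by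
  rw [pptWitness, mul_add, mul_smul_comm, Matrix.trace_add, Matrix.trace_smul,
    trace_pairProd_mul, trace_pairProd_mul]
  simp only [mul_add, mul_sub, sub_mul, smul_mul_assoc, mul_smul_comm, one_mul, mul_one,
    flipOp_mul_self, maxEnt_mul_self, Matrix.trace_add, Matrix.trace_sub, Matrix.trace_smul,
    Matrix.trace_one, trace_flipOp, trace_maxEnt, Fintype.card_prod, Fintype.card_fin, smul_eq_mul]
  push_cast
  ring

theorem smul_pairProd_smul {ι κ ι' κ' : Type*} (a b : ℂ) (M : Mat (ι × κ)) (N : Mat (ι' × κ')) :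
    pairProd (a • M) (b • N) = (a * b) • pairProd M N := by
  ext u v
  simp only [pairProd_apply, Matrix.smul_apply, smul_eq_mul]
  ring

end decomposition

/-! ### The two criteria. -/

theorem isDecomposable_tensorMap_wernerMap_iff (d : ℕ) (hd : 2 ≤ d) {p₁ p₂ : ℝ}
    (hp₁ : p₁ ∈ Set.Icc (0 : ℝ) 1) (hp₂ : p₂ ∈ Set.Icc (0 : ℝ) 1) :
    IsDecomposable (tensorMap (wernerMap d p₁) (transposeMap (Fin d) ∘ₗ wernerMap d p₂)) ↔
      0 ≤ ((d : ℝ) - 1) / ((d : ℝ) + 1) * p₁ * p₂ + (1 - p₁) * p₂ + p₁ * (1 - p₂)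
        - (1 - p₁) * (1 - p₂) := by
  have h1 : (1 : ℝ) < d := by exact_mod_cast hd
  have hk : 0 < 1 / ((d : ℝ) * (d ^ 2 - 1)) := by
    have : (0 : ℝ) < d ^ 2 - 1 := by nlinarith
    positivity
  have hf : ((d : ℝ) - 1) / ((d : ℝ) + 1) * p₁ * p₂ + (1 - p₁) * p₂ + p₁ * (1 - p₂)
      - (1 - p₁) * (1 - p₂) =
      ((d - 1) * p₁ * p₂ + (d + 1) * ((1 - p₁) * p₂ + p₁ * (1 - p₂)
      - (1 - p₁) * (1 - p₂))) / (d + 1) := by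
    field_simp
    ring
  rw [isDecomposable_iff_choi, choi_tensorMap, choi_transposeMap_comp, choi_wernerMap,
    choi_wernerMap, hf, le_div_iff₀ (by linarith), zero_mul]
  change IsDecomposableChoi _ ↔ _
  constructor
  · intro h
    have h2 := h.trace_mul_pptWitness_nonneg d (by omega)
    have hc : 0 < (1 / ((d : ℝ) * (d ^ 2 - 1))) * (1 / ((d : ℝ) * (d ^ 2 - 1))) *
        (2 * (d : ℝ) ^ 2 * (d - 1) ^ 2 * (d + 1) ^ 2) := by
      have : (0 : ℝ) < d - 1 := by linarith
      positivity
    rw [ptrans_wernerState_eq d hd, wernerState_eq d hd, smul_pairProd_smul, smul_mul_assoc,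
      Matrix.trace_smul, trace_pairProd_mul_pptWitness, smul_eq_mul] at h2
    rw [← mul_nonneg_iff_of_pos_left hc, ← Complex.zero_le_real]
    refine h2.trans_eq ?_
    push_cast
    ring
  · intro h
    rcases le_or_gt (1 / 2) p₂ with hq₂ | hq₂
    · exact .of_posSemidef (posSemidef_pairProd (posSemidef_wernerState d hd hp₁)
        (posSemidef_ptrans_wernerState d hd ⟨hq₂, hp₂.2⟩))
    rcases le_or_gt (1 / 2) p₁ with hq₁ | hq₁
    · refine .of_posSemidef_ptrans ?_
      rw [ptrans_pairProd, ptrans_ptrans]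
      exact posSemidef_pairProd (posSemidef_ptrans_wernerState d hd ⟨hq₁, hp₁.2⟩)
        (posSemidef_wernerState d hd hp₂)
    have hu₁ : 0 < d + 1 - 2 * d * p₁ := by nlinarith
    have hu₂ : 0 < d + 1 - 2 * d * p₂ := by nlinarith
    have hscale (u s : ℝ) (hu : 0 < u) (M : Mat (Fin d × Fin d)) :
        (s : ℂ) • (1 : Mat (Fin d × Fin d)) - (u : ℂ) • M =
          (u : ℂ) • (((s / u : ℝ) : ℂ) • 1 - M) := by
      have : (u : ℂ) ≠ 0 := by exact_mod_cast hu.ne'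
      push_cast
      match_scalars <;> field_simp
    rw [ptrans_wernerState_eq d hd, wernerState_eq d hd, smul_pairProd_smul, hscale _ _ hu₁,
      hscale _ _ hu₂, smul_pairProd_smul, ← Complex.ofReal_mul, ← Complex.ofReal_mul]
    refine .smul (.smul (isDecomposableChoi_pairProd d hd ?_ ?_ ?_) (mul_pos hu₁ hu₂).le)
      (mul_pos hk hk).le
    · rw [le_div_iff₀ hu₂]
      nlinarith [hp₂.1]
    · rw [div_le_iff₀ hu₂]
      have : 0 ≤ (d ^ 2 - 1) * (1 - 2 * p₂) := mul_nonneg (by nlinarith) (by linarith)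
      nlinarith
    -- With aᵢ = d+1-2dpᵢ, the difference of the two sides is 2(d-1)(d+1)/(a₁a₂) times the quantity
    -- in `h`.
    · rw [← sub_nonneg]
      refine (div_nonneg (mul_nonneg (a := 2 * ((d : ℝ) - 1) * (d + 1)) ?_ h)
        (mul_pos hu₁ hu₂).le).trans_eq ?_
      · exact mul_nonneg (by linarith) (by linarith)
      · have hu₁' := hu₁.ne'
        have hu₂' := hu₂.ne'
        generalize ha : (d : ℝ) + 1 - 2 * d * p₁ = a at hu₁' ⊢
        generalize hb : (d : ℝ) + 1 - 2 * d * p₂ = b at hu₂' ⊢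
        field_simp
        subst ha hb
        ring

/-- With k = √(2D/(D+1)) the expression factors as (1 - (2-k)p)((2+k)p - 1), and the first factor is
positive because k > 1 and p ≤ 1. -/
theorem quadratic_nonneg_iff_le {D p : ℝ} (hD : 1 < D) (hp : p ∈ Set.Icc (0 : ℝ) 1) :
    0 ≤ (D - 1) / (D + 1) * p * p + (1 - p) * p + p * (1 - p) - (1 - p) * (1 - p) ↔
      1 / (2 + √(2 * D / (D + 1))) ≤ p := by
  have hk : √(2 * D / (D + 1)) ^ 2 = 2 * D / (D + 1) := Real.sq_sqrt (by positivity)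
  have hk1 : 1 < √(2 * D / (D + 1)) := by
    rw [Real.lt_sqrt zero_le_one, lt_div_iff₀ (by linarith)]
    linarith
  have hD' : (D - 1) / (D + 1) = 2 * D / (D + 1) - 1 := by
    field_simp
    ring
  rw [hD', ← hk, Real.sqrt_sq (Real.sqrt_nonneg _)]
  generalize √(2 * D / (D + 1)) = k at hk1
  have hfac : (k ^ 2 - 1) * p * p + (1 - p) * p + p * (1 - p) - (1 - p) * (1 - p) =
      (1 - (2 - k) * p) * (p * (2 + k) - 1) := by
    ring
  have hpos : 0 < 1 - (2 - k) * p := by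
    rcases hp.1.eq_or_lt with rfl | h
    · norm_num
    · linarith [mul_pos (sub_pos.2 hk1) h, hp.2]
  rw [hfac, mul_nonneg_iff_of_pos_left hpos, sub_nonneg, div_le_iff₀ (by positivity)]

end WernerMaps

theorem mainTheorem8 (d : ℕ) (hd : 2 ≤ d) :
    (∀ p₁ ∈ Set.Icc (0 : ℝ) 1, ∀ p₂ ∈ Set.Icc (0 : ℝ) 1,
      (WernerMaps.IsDecomposable
          (WernerMaps.tensorMap (WernerMaps.wernerMap d p₁)
            (WernerMaps.transposeMap (Fin d) ∘ₗ WernerMaps.wernerMap d p₂)) ↔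
        0 ≤ ((d : ℝ) - 1) / ((d : ℝ) + 1) * p₁ * p₂ + (1 - p₁) * p₂ + p₁ * (1 - p₂)
          - (1 - p₁) * (1 - p₂))) ∧
    (∀ p ∈ Set.Icc (0 : ℝ) 1,
      (WernerMaps.IsDecomposable
          (WernerMaps.tensorMap (WernerMaps.wernerMap d p)
            (WernerMaps.transposeMap (Fin d) ∘ₗ WernerMaps.wernerMap d p)) ↔
        1 / (2 + Real.sqrt (2 * (d : ℝ) / ((d : ℝ) + 1))) ≤ p)) := by
  refine ⟨fun p₁ hp₁ p₂ hp₂ => WernerMaps.isDecomposable_tensorMap_wernerMap_iff d hd hp₁ hp₂,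
    fun p hp => ?_⟩
  rw [WernerMaps.isDecomposable_tensorMap_wernerMap_iff d hd hp hp]
  exact WernerMaps.quadratic_nonneg_iff_le (by exact_mod_cast hd) hp
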